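/- Let $n\in\{2,3\}$, let $\Omega\subset\mathbb R^n$ be a bounded domain (a non-empty, bounded, connected open set, for instance a polygonal or polyhedral domain with Lipschitz boundary), let $\nu>0$, let $\mathbb K\in\{\mathbb R,\mathbb C\}$, and let $\boldsymbol\beta\in W^{1,\infty}(\Omega;\mathbb K^n)$ be divergence free. Let $\|\boldsymbol\beta\|_{\infty,\Omega}$ be its $W^{1,\infty}$-norm, i.e. the larger of the essential suprema of $|\boldsymbol\beta|$ (Euclidean norm) and $|\nabla\boldsymbol\beta|$ (Frobenius norm). Notation. For vectors $s,r$ and tensors $A,B$ with entries in $\mathbb K$ put $s\cdot r=\sum_i s_i\overline{r_i}$, $(s\otimes r)_{ij}=s_i\overline{r_j}$, $A:B=\sum_{i,j}A_{ij}\overline{B_{ij}}$ and $A^{\mathtt d}=A-\frac1n\operatorname{tr}(A)\,I$. Let $Q=L^2(\Omega;\mathbb K^n)$ and $(f,v)_{0,\Omega}=\int_\Omega f\cdot v$. Let $\mathbb H$ be the space of $\tau\in L^2(\Omega;\mathbb K^{n\times n})$ whose row-wise weak divergence $\mathbf{div}\,\tau$ is in $Q$, with $\|\tau\|_{\mathbf{div}}^2=\|\tau\|_{0,\Omega}^2+\|\mathbf{div}\,\tau\|_{0,\Omega}^2$,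 and let $\mathbb H_0=\{\tau\in\mathbb H:\int_\Omega\operatorname{tr}\tau=0\}$. Define $$a(\rho,\tau)=\frac1\nu\int_\Omega\rho^{\mathtt d}:\tau^{\mathtt d},\qquad b(\tau,v)=\int_\Omega\mathbf{div}\,\tau\cdot v,\qquad c(v,\tau)=\frac1\nu\int_\Omega(v\otimes\boldsymbol\beta)^{\mathtt d}:\tau .$$ Constants. Let $c_1$ be the largest constant in $[0,\infty]$ with $c_1\|\tau\|_{\mathbf{div}}^2\le\|\tau^{\mathtt d}\|_{0,\Omega}^2+\|\mathbf{div}\,\tau\|_{0,\Omega}^2$ for all $\tau\in\mathbb H_0$, and let $\gamma$ be the largest constant in $[0,\infty]$ with $\sup_{0\ne\tau\in\mathbb H_0}|b(\tau,q)|/\|\tau\|_{\mathbf{div}}\ge\gamma\|q\|_{0,\Omega}$ for all $q\in Q$. (Both are positive and finite on bounded Lipschitz domains; the conditions below are read in $[0,\infty]$ with $1/0=\infty$ and $0\cdot\infty=0$.) Put $\|a\|=\min\{1,1/\nu\}$ and, for $f\in Q$, $$H=1+\frac{\nu}{c_1}\|a\|,\qquad C_1=\frac1{2\nu\gamma},\qquad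 C_2=\frac{C_1}{2\nu\gamma}\|\boldsymbol\beta\|_{\infty,\Omega}^2+\frac{\|a\|}{\gamma^2}\|f\|_{0,\Omega}.$$ Theorem. Let $f\in Q$. Assume that the data are small in the sense that for some real $R_0>0$ $$\frac{HC_1}{2}R_0^2-R_0+HC_2\le0\qquad\Bigl(\text{i.e. } \frac{HC_1}{2}R_0^2+HC_2\le R_0\Bigr),$$ and that $$\|\boldsymbol\beta\|_{\infty,\Omega}\max\Bigl\{\frac1\nu,\frac1{c_1}\Bigr\}<\gamma .$$ Then there is exactly one pair $(\hat\sigma,\hat u)\in\mathbb H_0\times Q$ such that $$a(\hat\sigma,\tau)+\overline{b(\tau,\hat u)}+c(\hat u,\tau)=0\quad\text{for all }\tau\in\mathbb H_0,\qquad b(\hat\sigma,v)=-(f,v)_{0,\Omega}\quad\text{for all }v\in Q .$$ (Over $\mathbb R$ the conjugation bar has no effect.) -/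

import Mathlib

open MeasureTheory Set
open scoped ENNReal ContDiff ComplexConjugate

namespace Oseen

/-- Points of the physical space, with the Euclidean norm. -/
abbrev Pt (n : ℕ) : Type := EuclideanSpace ℝ (Fin n)

/-- Vectors with entries in `𝕜` (`ℝ` or `ℂ`), with the Euclidean norm. -/
abbrev Vec (𝕜 : Type) (n : ℕ) : Type := EuclideanSpace 𝕜 (Fin n)

/-- `n × n` tensors with entries in `𝕜`, with the Frobenius norm; `A (i, j)` is the entry in
row `i` and column `j`. -/
abbrev Ten (𝕜 : Type) (n : ℕ) : Type := EuclideanSpace 𝕜 (Fin n × Fin n)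

/-- The space `Q = L²(Ω)` of square integrable vector fields. -/
abbrev L2Vec (𝕜 : Type) [RCLike 𝕜] {n : ℕ} (Ω : Set (Pt n)) : Type :=
  Lp (Vec 𝕜 n) 2 (volume.restrict Ω)

/-- The space of square integrable tensor fields. -/
abbrev L2Ten (𝕜 : Type) [RCLike 𝕜] {n : ℕ} (Ω : Set (Pt n)) : Type :=
  Lp (Ten 𝕜 n) 2 (volume.restrict Ω)

/-! ### Tensor algebra -/

/-- The trace of a tensor. -/
def tr {𝕜 : Type} [RCLike 𝕜] {n : ℕ} (A : Ten 𝕜 n) : 𝕜 := ∑ i, A (i, i)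

/-- The deviatoric part `A - (1/n) tr(A) I`. -/
noncomputable def dev {𝕜 : Type} [RCLike 𝕜] {n : ℕ} (A : Ten 𝕜 n) : Ten 𝕜 n :=
  WithLp.toLp 2 fun p => A p - if p.1 = p.2 then tr A / (n : 𝕜) else 0

/-- The product `A : B = ∑ᵢⱼ Aᵢⱼ conj(Bᵢⱼ)`. -/
def ddot {𝕜 : Type} [RCLike 𝕜] {n : ℕ} (A B : Ten 𝕜 n) : 𝕜 := ∑ p, A p * conj (B p)

/-- The product `s · r = ∑ᵢ sᵢ conj(rᵢ)`. -/
def dot {𝕜 : Type} [RCLike 𝕜] {n : ℕ} (s r : Vec 𝕜 n) : 𝕜 := ∑ i, s i * conj (r i)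

/-- The dyadic product `(s ⊗ r)ᵢⱼ = sᵢ conj(rⱼ)`. -/
def dyad {𝕜 : Type} [RCLike 𝕜] {n : ℕ} (s r : Vec 𝕜 n) : Ten 𝕜 n :=
  WithLp.toLp 2 fun p => s p.1 * conj (r p.2)

/-! ### Weak derivatives -/

/-- `φ ∈ C_c^∞(Ω)`. -/
def IsTest {n : ℕ} (Ω : Set (Pt n)) (φ : Pt n → ℝ) : Prop :=
  ContDiff ℝ ∞ φ ∧ HasCompactSupport φ ∧ tsupport φ ⊆ Ω

/-- The classical partial derivative `∂ⱼ φ`. -/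
noncomputable def pd {n : ℕ} (φ : Pt n → ℝ) (j : Fin n) (x : Pt n) : ℝ :=
  fderiv ℝ φ x (EuclideanSpace.single j 1)

/-- `g` is the row-wise weak divergence of `τ` on `Ω`: `gᵢ = ∑ⱼ ∂ⱼ τᵢⱼ`. -/
def HasWeakDiv {𝕜 : Type} [RCLike 𝕜] {n : ℕ} (Ω : Set (Pt n))
    (τ : Pt n → Ten 𝕜 n) (g : Pt n → Vec 𝕜 n) : Prop :=
  ∀ φ : Pt n → ℝ, IsTest Ω φ → ∀ i : Fin n,
    ∫ x in Ω, ∑ j, pd φ j x • τ x (i, j) = - ∫ x in Ω, φ x • g x i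

/-- `G` is the weak gradient of `β` on `Ω`: `Gᵢⱼ = ∂ⱼ βᵢ`. -/
def HasWeakGrad {𝕜 : Type} [RCLike 𝕜] {n : ℕ} (Ω : Set (Pt n))
    (β : Pt n → Vec 𝕜 n) (G : Pt n → Ten 𝕜 n) : Prop :=
  ∀ φ : Pt n → ℝ, IsTest Ω φ → ∀ i j : Fin n,
    ∫ x in Ω, pd φ j x • β x i = - ∫ x in Ω, φ x • G x (i, j)

/-! ### The spaces `H(div)`, `H_0` and their norm -/

/-- `H(div, Ω)`: square integrable tensor fields with square integrable weak divergence. -/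
def Hdiv (𝕜 : Type) [RCLike 𝕜] {n : ℕ} (Ω : Set (Pt n)) : Set (L2Ten 𝕜 Ω) :=
  {τ | ∃ g : L2Vec 𝕜 Ω, HasWeakDiv Ω τ g}

open Classical in
/-- The weak divergence of a tensor field in `H(div, Ω)` (and `0` for other fields). -/
noncomputable def divg {𝕜 : Type} [RCLike 𝕜] {n : ℕ} {Ω : Set (Pt n)} (τ : L2Ten 𝕜 Ω) :
    L2Vec 𝕜 Ω :=
  if h : ∃ g : L2Vec 𝕜 Ω, HasWeakDiv Ω τ g then h.choose else 0

/-- `H_0`: the fields `τ` in `H(div, Ω)` with `∫_Ω tr τ = 0`. -/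
def H0 (𝕜 : Type) [RCLike 𝕜] {n : ℕ} (Ω : Set (Pt n)) : Set (L2Ten 𝕜 Ω) :=
  {τ | τ ∈ Hdiv 𝕜 Ω ∧ ∫ x in Ω, tr (τ x) = 0}

/-- The norm of `H(div, Ω)`. -/
noncomputable def divNorm {𝕜 : Type} [RCLike 𝕜] {n : ℕ} {Ω : Set (Pt n)} (τ : L2Ten 𝕜 Ω) : ℝ :=
  Real.sqrt (‖τ‖ ^ 2 + ‖divg τ‖ ^ 2)

/-! ### The space `W^{1,∞}` -/

/-- `β ∈ W^{1,∞}(Ω)`. -/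
def MemW1Inf {𝕜 : Type} [RCLike 𝕜] {n : ℕ} (Ω : Set (Pt n)) (β : Pt n → Vec 𝕜 n) : Prop :=
  MemLp β ∞ (volume.restrict Ω) ∧
    ∃ G : Pt n → Ten 𝕜 n, MemLp G ∞ (volume.restrict Ω) ∧ HasWeakGrad Ω β G

open Classical in
/-- The weak gradient of a field in `W^{1,∞}(Ω)` (and `0` for other fields). -/
noncomputable def weakGrad {𝕜 : Type} [RCLike 𝕜] {n : ℕ} (Ω : Set (Pt n))
    (β : Pt n → Vec 𝕜 n) : Pt n → Ten 𝕜 n :=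
  if h : ∃ G : Pt n → Ten 𝕜 n, MemLp G ∞ (volume.restrict Ω) ∧ HasWeakGrad Ω β G
  then h.choose else 0

/-- The norm of `W^{1,∞}(Ω)`: the larger of the essential suprema of `|β|` and `|∇β|`. -/
noncomputable def w1InfNorm {𝕜 : Type} [RCLike 𝕜] {n : ℕ} (Ω : Set (Pt n))
    (β : Pt n → Vec 𝕜 n) : ℝ≥0∞ :=
  max (eLpNorm β ∞ (volume.restrict Ω)) (eLpNorm (weakGrad Ω β) ∞ (volume.restrict Ω))

/-- `div β = 0` in `Ω`. -/
def IsDivFree {𝕜 : Type} [RCLike 𝕜] {n : ℕ} (Ω : Set (Pt n)) (β : Pt n → Vec 𝕜 n) : Prop :=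
  ∀ᵐ x ∂(volume.restrict Ω), tr (weakGrad Ω β x) = 0

/-! ### The forms and the source problem -/

/-- `a(ρ, τ) = (1/ν) ∫_Ω ρᵈ : τᵈ`. -/
noncomputable def formA {𝕜 : Type} [RCLike 𝕜] {n : ℕ} {Ω : Set (Pt n)} (ν : ℝ)
    (ρ τ : L2Ten 𝕜 Ω) : 𝕜 :=
  ((1 / ν : ℝ) : 𝕜) * ∫ x in Ω, ddot (dev (ρ x)) (dev (τ x))

/-- `b(τ, v) = ∫_Ω div τ · v`. -/
noncomputable def formB {𝕜 : Type} [RCLike 𝕜] {n : ℕ} {Ω : Set (Pt n)}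
    (τ : L2Ten 𝕜 Ω) (v : L2Vec 𝕜 Ω) : 𝕜 :=
  ∫ x in Ω, dot (divg τ x) (v x)

/-- `c(v, τ) = (1/ν) ∫_Ω (v ⊗ β)ᵈ : τ`. -/
noncomputable def formC {𝕜 : Type} [RCLike 𝕜] {n : ℕ} {Ω : Set (Pt n)} (ν : ℝ)
    (β : Pt n → Vec 𝕜 n) (v : L2Vec 𝕜 Ω) (τ : L2Ten 𝕜 Ω) : 𝕜 :=
  ((1 / ν : ℝ) : 𝕜) * ∫ x in Ω, ddot (dev (dyad (v x) (β x))) (τ x)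

/-- `(σ, u) ∈ H_0 × Q` solves the source problem with right-hand side `f`. In the first equation
the test field is `τ`, so it is `τ` that is conjugated in `∫_Ω u · div τ`, which is the complex
conjugate of `b(τ, u)` (and `b(τ, u)` itself over `ℝ`). -/
def IsSourceSolution {𝕜 : Type} [RCLike 𝕜] {n : ℕ} {Ω : Set (Pt n)} (ν : ℝ)
    (β : Pt n → Vec 𝕜 n) (f : L2Vec 𝕜 Ω) (σ : L2Ten 𝕜 Ω) (u : L2Vec 𝕜 Ω) : Prop :=
  σ ∈ H0 𝕜 Ω ∧
  (∀ τ ∈ H0 𝕜 Ω, formA ν σ τ + conj (formB τ u) + formC ν β u τ = 0) ∧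
  (∀ v : L2Vec 𝕜 Ω, formB σ v = - ∫ x in Ω, dot (f x) (v x))

/-! ### The constants, with values in `[0, ∞]` -/

/-- The largest `c₁` with `c₁ ‖τ‖²_div ≤ ‖τᵈ‖²_{L²} + ‖div τ‖²_{L²}` for all `τ ∈ H_0`. -/
noncomputable def c1 (𝕜 : Type) [RCLike 𝕜] {n : ℕ} (Ω : Set (Pt n)) : ℝ≥0∞ :=
  sSup {c : ℝ≥0∞ | ∀ τ ∈ H0 𝕜 Ω, c * ENNReal.ofReal (divNorm τ ^ 2) ≤
    ENNReal.ofReal ((∫ x in Ω, ‖dev (τ x)‖ ^ 2) + ‖divg τ‖ ^ 2)}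

/-- The largest `γ` with `sup_{τ ∈ H_0} |b(τ, q)| / ‖τ‖_div ≥ γ ‖q‖_{L²}` for all `q ∈ Q`.
(The quotient is `0 / 0 = 0` at `τ = 0`.) -/
noncomputable def gam (𝕜 : Type) [RCLike 𝕜] {n : ℕ} (Ω : Set (Pt n)) : ℝ≥0∞ :=
  sSup {g : ℝ≥0∞ | ∀ q : L2Vec 𝕜 Ω, g * ‖q‖ₑ ≤
    ⨆ τ ∈ H0 𝕜 Ω, ‖formB τ q‖ₑ / ENNReal.ofReal (divNorm τ)}

/-- `‖a‖ := min {1, 1/ν}`. -/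
noncomputable def normA (ν : ℝ) : ℝ≥0∞ := min 1 (1 / ENNReal.ofReal ν)

/-- `H = 1 + (ν / c₁) ‖a‖`. -/
noncomputable def constH (𝕜 : Type) [RCLike 𝕜] {n : ℕ} (Ω : Set (Pt n)) (ν : ℝ) : ℝ≥0∞ :=
  1 + ENNReal.ofReal ν / c1 𝕜 Ω * normA ν

/-- `C₁ = 1 / (2 ν γ)`. -/
noncomputable def constC1 (𝕜 : Type) [RCLike 𝕜] {n : ℕ} (Ω : Set (Pt n)) (ν : ℝ) : ℝ≥0∞ :=
  1 / (2 * ENNReal.ofReal ν * gam 𝕜 Ω)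

/-- `C₂ = (C₁ / (2 ν γ)) ‖β‖²_∞ + (‖a‖ / γ²) ‖f‖`. -/
noncomputable def constC2 {𝕜 : Type} [RCLike 𝕜] {n : ℕ} {Ω : Set (Pt n)} (ν : ℝ)
    (β : Pt n → Vec 𝕜 n) (f : L2Vec 𝕜 Ω) : ℝ≥0∞ :=
  constC1 𝕜 Ω ν / (2 * ENNReal.ofReal ν * gam 𝕜 Ω) * w1InfNorm Ω β ^ 2
    + normA ν / gam 𝕜 Ω ^ 2 * ‖f‖ₑ

/-- The smallness condition `(H C₁ / 2) R₀² - R₀ + H C₂ ≤ 0` for some finite `R₀ > 0`, with `R₀`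
moved to the right-hand side. -/
def SmallData {𝕜 : Type} [RCLike 𝕜] {n : ℕ} {Ω : Set (Pt n)} (ν : ℝ)
    (β : Pt n → Vec 𝕜 n) (f : L2Vec 𝕜 Ω) : Prop :=
  ∃ R₀ : ℝ, 0 < R₀ ∧
    constH 𝕜 Ω ν * constC1 𝕜 Ω ν / 2 * ENNReal.ofReal R₀ ^ 2 + constH 𝕜 Ω ν * constC2 ν β f
      ≤ ENNReal.ofReal R₀

/-! ### Weak divergences and weak gradients are unique -/

theorem ae_eq_of_test {𝕜 : Type} [RCLike 𝕜] {n : ℕ} {Ω : Set (Pt n)} (hΩ : IsOpen Ω)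
    {f g : Pt n → 𝕜} (hf : LocallyIntegrable f (volume.restrict Ω))
    (hg : LocallyIntegrable g (volume.restrict Ω))
    (h : ∀ φ : Pt n → ℝ, IsTest Ω φ → ∫ x in Ω, φ x • f x = ∫ x in Ω, φ x • g x) :
    f =ᵐ[volume.restrict Ω] g := by
  have h0 : ∀ᵐ x ∂(volume : Measure (Pt n)), x ∈ Ω → (f - g) x = 0 := by
    refine IsOpen.ae_eq_zero_of_integral_contDiff_smul_eq_zero hΩ
      (locallyIntegrableOn_of_locallyIntegrable_restrict (hf.sub hg)) ?_
    intro φ hφ hc hs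
    have e : ∫ x, φ x • (f - g) x = ∫ x in Ω, φ x • (f - g) x := by
      refine (setIntegral_eq_integral_of_forall_compl_eq_zero ?_).symm
      intro x hx
      have : φ x = 0 := by
        by_contra hne
        exact hx (hs (subset_tsupport _ hne))
      simp [this]
    rw [e]
    have i1 := hf.integrable_smul_left_of_hasCompactSupport hφ.continuous hc
    have i2 := hg.integrable_smul_left_of_hasCompactSupport hφ.continuous hc
    simp only [Pi.sub_apply, smul_sub]
    rw [integral_sub i1 i2, h φ ⟨hφ, hc, hs⟩, sub_self]
  filter_upwards [(ae_restrict_iff' (IsOpen.measurableSet hΩ)).2 h0] with x hx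
  exact sub_eq_zero.1 hx

theorem HasWeakDiv.unique {𝕜 : Type} [RCLike 𝕜] {n : ℕ} {Ω : Set (Pt n)} (hΩ : IsOpen Ω)
    {τ : Pt n → Ten 𝕜 n} {g g' : L2Vec 𝕜 Ω} (h : HasWeakDiv Ω τ g) (h' : HasWeakDiv Ω τ g') :
    g = g' := by
  have key : ∀ (v : L2Vec 𝕜 Ω) (i : Fin n), LocallyIntegrable (fun x => v x i) (volume.restrict Ω) := by
    intro v i
    have h1 : MemLp (fun x => v x i) 2 (volume.restrict Ω) :=
      (Lp.memLp v).continuousLinearMap_comp (EuclideanSpace.proj (𝕜 := 𝕜) i)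
    exact h1.locallyIntegrable (by norm_num)
  have hi : ∀ i : Fin n, ∀ᵐ x ∂(volume.restrict Ω), g x i = g' x i := by
    intro i
    refine ae_eq_of_test hΩ (key g i) (key g' i) fun φ hφ => ?_
    exact neg_injective ((h φ hφ i).symm.trans (h' φ hφ i))
  refine Lp.ext ?_
  filter_upwards [ae_all_iff.2 hi] with x hx
  ext i
  exact hx i

theorem divg_eq {𝕜 : Type} [RCLike 𝕜] {n : ℕ} {Ω : Set (Pt n)} (hΩ : IsOpen Ω)
    {τ : L2Ten 𝕜 Ω} {g : L2Vec 𝕜 Ω} (h : HasWeakDiv Ω τ g) : divg τ = g := by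
  have hex : ∃ g : L2Vec 𝕜 Ω, HasWeakDiv Ω τ g := ⟨g, h⟩
  have : divg τ = hex.choose := dif_pos hex
  rw [this]
  exact HasWeakDiv.unique hΩ hex.choose_spec h

theorem HasWeakGrad.unique {𝕜 : Type} [RCLike 𝕜] {n : ℕ} {Ω : Set (Pt n)} (hΩ : IsOpen Ω)
    {β : Pt n → Vec 𝕜 n} {G G' : Pt n → Ten 𝕜 n}
    (hG : MemLp G ∞ (volume.restrict Ω)) (hG' : MemLp G' ∞ (volume.restrict Ω))
    (h : HasWeakGrad Ω β G) (h' : HasWeakGrad Ω β G') : G =ᵐ[volume.restrict Ω] G' := by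
  have key : ∀ {F : Pt n → Ten 𝕜 n}, MemLp F ∞ (volume.restrict Ω) → ∀ p : Fin n × Fin n,
      LocallyIntegrable (fun x => F x p) (volume.restrict Ω) := by
    intro F hF p
    have h1 : MemLp (fun x => F x p) ∞ (volume.restrict Ω) :=
      hF.continuousLinearMap_comp (EuclideanSpace.proj (𝕜 := 𝕜) p)
    exact h1.locallyIntegrable (by norm_num)
  have hi : ∀ p : Fin n × Fin n, ∀ᵐ x ∂(volume.restrict Ω), G x p = G' x p := by
    rintro ⟨i, j⟩
    refine ae_eq_of_test hΩ (key hG _) (key hG' _) fun φ hφ => ?_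
    exact neg_injective ((h φ hφ i j).symm.trans (h' φ hφ i j))
  filter_upwards [ae_all_iff.2 hi] with x hx
  ext p
  exact hx p

end Oseen

/-! The graph of the divergence on `H0` is a closed subspace of L² × L², hence a Hilbert space X
whose norm is `divNorm`. Write P for the deviator and D for the divergence on X, and C u = (u ⊗ β)ᵈ.
After multiplication by ν the problem reads ⟨Pτ, Pσ + Cu⟩ + ν⟨Dτ, u⟩ = 0 for all τ, with Dσ = -f
(`isSourceSolution_iff`).

The inf-sup condition bounds D* below by any admissible g, so D D* is invertible and D* has range
(ker D)ᗮ. Coercivity makes P(ker D) closed. Projecting Pσ + Cu onto P(ker D)ᗮ eliminates σ and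
leaves a fixed-point equation for u. Projection and P* do not increase norms, so its map has
Lipschitz constant ‖β‖/(νg) < 1 (`existsUnique_perturbed_saddle`).

Small data enters through c₁ > 0: in [0, ∞] the value c₁ = 0 would make H infinite
(`c1_pos_of_smallData`). -/

namespace Oseen

/-! ### Perturbed saddle point problems in Hilbert spaces -/

section Abstract

open ContinuousLinearMap

variable {𝕜 X Y Q : Type*} [RCLike 𝕜]
  [NormedAddCommGroup X] [InnerProductSpace 𝕜 X] [CompleteSpace X]
  [NormedAddCommGroup Y] [InnerProductSpace 𝕜 Y]
  [NormedAddCommGroup Q] [InnerProductSpace 𝕜 Q]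

/-- The part of the range of `P` over the kernel of `D` is closed. -/
theorem isClosed_map_ker (P : X →L[𝕜] Y) (D : X →L[𝕜] Q) {c : ℝ} (hc : 0 < c)
    (hcoer : ∀ τ, c * ‖τ‖ ^ 2 ≤ ‖P τ‖ ^ 2 + ‖D τ‖ ^ 2) :
    IsClosed (D.ker.map (P : X →ₗ[𝕜] Y) : Set Y) := by
  -- On ker D the coercivity estimate loses its D term, so P is bounded below by √c there;
  -- completeness of ker D then closes the image.
  have hbd : ∀ k : D.ker, ‖k‖ ≤ ((Real.toNNReal (Real.sqrt c))⁻¹ : NNReal) *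
      ‖(P ∘L D.ker.subtypeL) k‖ := by
    intro k
    have hk : D k = 0 := k.2
    have h1 := hcoer k
    rw [hk, norm_zero] at h1
    have hs := Real.sqrt_pos.2 hc
    rw [NNReal.coe_inv, Real.coe_toNNReal _ hs.le, inv_mul_eq_div, le_div_iff₀ hs]
    refine le_of_sq_le_sq ?_ (norm_nonneg _)
    rw [mul_pow, Real.sq_sqrt hc.le]
    simpa [mul_comm] using h1
  have hanti := (P ∘L D.ker.subtypeL).antilipschitz_of_bound hbd
  have : CompleteSpace D.ker := D.isClosed_ker.completeSpace_coe
  have hcl := hanti.isClosed_range (P ∘L D.ker.subtypeL).uniformContinuous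
  convert hcl using 1
  ext y
  simp

variable [CompleteSpace Y] [CompleteSpace Q]

/-- An operator whose adjoint is bounded below is surjective. -/
theorem surjective_of_adjoint_bddBelow (D : X →L[𝕜] Q) {g : ℝ} (hg : 0 < g)
    (h : ∀ q, g * ‖q‖ ≤ ‖adjoint D q‖) :
    Function.Surjective (D ∘L adjoint D) := by
  -- D D* is coercive: ⟨D D* q, q⟩ = ‖D* q‖² ≥ g²‖q‖².
  have hu : IsUnit (D ∘L adjoint D) := by
    refine isUnit_of_forall_le_norm_inner_map _ (c := ⟨g ^ 2, by positivity⟩)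
      (show (0 : ℝ) < g ^ 2 by positivity) fun q => ?_
    rw [comp_apply, ← adjoint_inner_right, inner_self_eq_norm_sq_to_K, norm_pow,
      RCLike.norm_ofReal, abs_norm]
    calc ‖q‖ ^ 2 * g ^ 2 = (g * ‖q‖) ^ 2 := by ring
      _ ≤ _ := by gcongr; exact h q
  exact (isUnit_iff_bijective.1 hu).2

/-- If the adjoint is bounded below, its range is the orthogonal complement of the kernel. -/
theorem exists_adjoint_eq_of_forall_ker (D : X →L[𝕜] Q) {g : ℝ} (hg : 0 < g)
    (h : ∀ q, g * ‖q‖ ≤ ‖adjoint D q‖) {y : X} (hy : ∀ τ, D τ = 0 → inner 𝕜 τ y = 0) :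
    ∃ q, adjoint D q = y := by
  -- With D D* q = D y, the difference D* q - y lies in ker D and is orthogonal to ker D, hence
  -- vanishes.
  obtain ⟨q, hq⟩ := surjective_of_adjoint_bddBelow D hg h (D y)
  refine ⟨q, ?_⟩
  have h0 : D (adjoint D q - y) = 0 := by
    rw [map_sub, sub_eq_zero]; exact hq
  have h1 : inner 𝕜 (adjoint D q - y) (adjoint D q - y) = 0 := by
    rw [inner_sub_right, hy _ h0, adjoint_inner_right, h0, inner_zero_left, sub_zero]
  exact sub_eq_zero.1 (inner_self_eq_zero.1 h1)

theorem norm_adjoint_apply_le (P : X →L[𝕜] Y) (hP : ∀ τ, ‖P τ‖ ≤ ‖τ‖) (y : Y) :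
    ‖adjoint P y‖ ≤ ‖y‖ := by
  have h1 : ‖adjoint P‖ ≤ 1 := by
    rw [LinearIsometryEquiv.norm_map]
    exact P.opNorm_le_bound zero_le_one fun τ => by simpa using hP τ
  simpa using (adjoint P).le_of_opNorm_le h1 y

/-- The homogeneous perturbed saddle point problem has only the zero solution. -/
theorem perturbed_saddle_eq_zero (P : X →L[𝕜] Y) (D : X →L[𝕜] Q) (C : Q →L[𝕜] Y)
    {c g ν M : ℝ} (hc : 0 < c) (hν : 0 < ν) (hMg : M < ν * g)
    (hP : ∀ τ, ‖P τ‖ ≤ ‖τ‖)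
    (hcoer : ∀ τ, c * ‖τ‖ ^ 2 ≤ ‖P τ‖ ^ 2 + ‖D τ‖ ^ 2)
    (hD : ∀ q, g * ‖q‖ ≤ ‖adjoint D q‖)
    (hC : ∀ q, ‖C q‖ ≤ M * ‖q‖) {σ : X} {u : Q}
    (h : ∀ τ, inner 𝕜 (P τ) (P σ + C u) + (ν : 𝕜) * inner 𝕜 (D τ) u = 0) (hσ : D σ = 0) :
    σ = 0 ∧ u = 0 := by
  -- Testing with σ itself makes Cu the hypotenuse of a right triangle with legs Pσ and Pσ + Cu.
  -- This gives ‖Pσ + Cu‖ ≤ ‖Cu‖ without a factor depending on c.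
  have horth : inner 𝕜 (P σ) (P σ + C u) = 0 := by
    simpa [hσ] using h σ
  have hsq : ‖C u‖ ^ 2 = ‖P σ‖ ^ 2 + ‖P σ + C u‖ ^ 2 := by
    have h1 := norm_sub_sq (𝕜 := 𝕜) (P σ + C u) (P σ)
    rw [add_sub_cancel_left, ← inner_conj_symm, horth] at h1
    simp only [map_zero, mul_zero, sub_zero] at h1
    linarith
  have hle : ‖P σ + C u‖ ≤ ‖C u‖ :=
    le_of_sq_le_sq (by nlinarith [sq_nonneg ‖P σ‖]) (norm_nonneg _)
  have hadj : adjoint P (P σ + C u) = -((ν : 𝕜) • adjoint D u) := by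
    rw [eq_neg_iff_add_eq_zero]
    refine ext_inner_left 𝕜 fun τ => ?_
    rw [inner_add_right, inner_smul_right, adjoint_inner_right, adjoint_inner_right, h,
      inner_zero_right]
  have hu : u = 0 := by
    by_contra hne
    have hpos := norm_pos_iff.2 hne
    have h1 : ν * ‖adjoint D u‖ ≤ M * ‖u‖ := by
      have h2 := norm_adjoint_apply_le P hP (P σ + C u)
      rw [hadj, norm_neg, norm_smul, RCLike.norm_ofReal, abs_of_pos hν] at h2
      exact (h2.trans hle).trans (hC u)
    have h2 := mul_le_mul_of_nonneg_left (hD u) hν.le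
    have h3 := mul_lt_mul_of_pos_right hMg hpos
    linarith
  refine ⟨?_, hu⟩
  have hPσ : ‖P σ‖ ^ 2 = 0 := by
    rw [hu, map_zero, norm_zero] at hsq
    nlinarith [sq_nonneg ‖P σ‖, sq_nonneg ‖P σ + 0‖]
  have h1 := hcoer σ
  rw [hPσ, hσ, norm_zero] at h1
  have h2 : ‖σ‖ ^ 2 = 0 := le_antisymm (by nlinarith) (sq_nonneg _)
  exact norm_eq_zero.1 (pow_eq_zero_iff two_ne_zero |>.1 h2)

/-- Banach's fixed-point theorem in u: freeze w in the term C w, solve for the new multiplier, and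
recover σ by correcting a particular solution of D σ₀ = f by an element of ker D. -/
theorem existsUnique_perturbed_saddle (P : X →L[𝕜] Y) (D : X →L[𝕜] Q) (C : Q →L[𝕜] Y)
    {c g ν M : ℝ} (hc : 0 < c) (hg : 0 < g) (hν : 0 < ν) (hM : 0 ≤ M) (hMg : M < ν * g)
    (hP : ∀ τ, ‖P τ‖ ≤ ‖τ‖)
    (hcoer : ∀ τ, c * ‖τ‖ ^ 2 ≤ ‖P τ‖ ^ 2 + ‖D τ‖ ^ 2)
    (hD : ∀ q, g * ‖q‖ ≤ ‖adjoint D q‖)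
    (hC : ∀ q, ‖C q‖ ≤ M * ‖q‖) (f : Q) :
    ∃! p : X × Q, (∀ τ, inner 𝕜 (P τ) (P p.1 + C p.2) + (ν : 𝕜) * inner 𝕜 (D τ) p.2 = 0) ∧
      D p.1 = f := by
  have hνK : (ν : 𝕜) ≠ 0 := RCLike.ofReal_ne_zero.2 hν.ne'
  obtain ⟨q₀, hq₀⟩ := surjective_of_adjoint_bddBelow D hg hD f
  set σ₀ := adjoint D q₀
  have hσ₀ : D σ₀ = f := hq₀
  set R : Submodule 𝕜 Y := D.ker.map (P : X →ₗ[𝕜] Y) with hR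
  have hRc : CompleteSpace R := (isClosed_map_ker P D hc hcoer).completeSpace_coe
  -- The component of Pσ₀ + Cw orthogonal to P(ker D), pulled back by P*, annihilates ker D and
  -- therefore lies in the range of D*.
  have hex : ∀ w : Q, ∃ q, adjoint D q =
      -((ν : 𝕜)⁻¹ • adjoint P (Rᗮ.starProjection (P σ₀ + C w))) := by
    intro w
    refine exists_adjoint_eq_of_forall_ker D hg hD fun τ hτ => ?_
    have hmem : P τ ∈ R := ⟨τ, hτ, rfl⟩
    rw [inner_neg_right, inner_smul_right, adjoint_inner_right,
      (Submodule.mem_orthogonal R _).1 (Submodule.starProjection_apply_mem _ _) _ hmem,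
      mul_zero, neg_zero]
  choose T hT using hex
  have hT' : ContractingWith (Real.toNNReal (M / (ν * g))) T := by
    have hnn : 0 ≤ M / (ν * g) := by positivity
    refine ⟨?_, LipschitzWith.of_dist_le_mul fun w w' => ?_⟩
    · rw [← NNReal.coe_lt_coe, Real.coe_toNNReal _ hnn]
      exact (div_lt_one (by positivity)).2 hMg
    · rw [Real.coe_toNNReal _ hnn, dist_eq_norm, dist_eq_norm, div_mul_eq_mul_div,
        le_div_iff₀ (by positivity)]
      have e : adjoint D (T w - T w') =
          -((ν : 𝕜)⁻¹ • adjoint P (Rᗮ.starProjection (C (w - w')))) := by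
        rw [map_sub, hT, hT, map_sub C, ← add_sub_add_left_eq_sub (C w) (C w') (P σ₀),
          map_sub, map_sub, smul_sub]
        abel
      have h1 := hD (T w - T w')
      rw [e, norm_neg, norm_smul, norm_inv, RCLike.norm_ofReal, abs_of_pos hν] at h1
      have h2 : ‖adjoint P (Rᗮ.starProjection (C (w - w')))‖ ≤ M * ‖w - w'‖ :=
        ((norm_adjoint_apply_le P hP _).trans (Submodule.norm_starProjection_apply_le _ _)).trans
          (hC _)
      calc ‖T w - T w'‖ * (ν * g) = ν * (g * ‖T w - T w'‖) := by ring
        _ ≤ ν * (ν⁻¹ * ‖adjoint P (Rᗮ.starProjection (C (w - w')))‖) := by gcongr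
        _ = ‖adjoint P (Rᗮ.starProjection (C (w - w')))‖ := by field_simp
        _ ≤ _ := h2
  obtain ⟨u, hu⟩ : ∃ u, T u = u := ⟨_, hT'.fixedPoint_isFixedPt⟩
  -- Since P(ker D) is closed, the projected part is exactly Pk with k in ker D. Subtracting k from
  -- σ₀ removes this part and keeps the divergence.
  obtain ⟨k, hk, hPk⟩ : R.starProjection (P σ₀ + C u) ∈ R := Submodule.starProjection_apply_mem _ _
  have hk0 : D k = 0 := hk
  have hPk' : P k = R.starProjection (P σ₀ + C u) := hPk
  have hsol : ∀ τ, inner 𝕜 (P τ) (P (σ₀ - k) + C u) + (ν : 𝕜) * inner 𝕜 (D τ) u = 0 := by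
    intro τ
    have e1 : P (σ₀ - k) + C u = Rᗮ.starProjection (P σ₀ + C u) := by
      rw [Submodule.starProjection_orthogonal_val, map_sub, hPk']
      abel
    have e2 := hT u
    rw [hu] at e2
    rw [e1, ← adjoint_inner_right D, e2, inner_neg_right, inner_smul_right,
      adjoint_inner_right, mul_neg, mul_inv_cancel_left₀ hνK, add_neg_cancel]
  have hDσ : D (σ₀ - k) = f := by rw [map_sub, hk0, hσ₀, sub_zero]
  refine ⟨(σ₀ - k, u), ⟨hsol, hDσ⟩, ?_⟩
  rintro ⟨σ', u'⟩ ⟨h1, h2⟩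
  obtain ⟨hσ, hu'⟩ := perturbed_saddle_eq_zero P D C hc hν hMg hP hcoer hD hC
    (σ := σ' - (σ₀ - k)) (u := u' - u) (fun τ => by
      have := congrArg₂ (· - ·) (h1 τ) (hsol τ)
      simp only [sub_zero] at this
      rw [← this, map_sub P σ', map_sub C, sub_add_sub_comm, inner_sub_right, inner_sub_right]
      ring) (by rw [map_sub, hDσ]; exact sub_eq_zero.2 h2)
  exact Prod.ext (sub_eq_zero.1 hσ) (sub_eq_zero.1 hu')

end Abstract
variable {𝕜 : Type} [RCLike 𝕜] {n : ℕ}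

/-! ### Pointwise tensor algebra -/

theorem ddot_eq_inner (A B : Ten 𝕜 n) : ddot A B = inner 𝕜 B A := by
  simp [ddot, PiLp.inner_apply]

theorem dot_eq_inner (s r : Vec 𝕜 n) : dot s r = inner 𝕜 r s := by
  simp [dot, PiLp.inner_apply]

theorem dev_apply (A : Ten 𝕜 n) (p : Fin n × Fin n) :
    dev A p = A p - if p.1 = p.2 then tr A / (n : 𝕜) else 0 := rfl

theorem tr_add (A B : Ten 𝕜 n) : tr (A + B) = tr A + tr B := by
  simp [tr, Finset.sum_add_distrib]

theorem tr_smul (a : 𝕜) (A : Ten 𝕜 n) : tr (a • A) = a * tr A := by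
  simp [tr, Finset.mul_sum]

theorem tr_dev (hn : n ≠ 0) (A : Ten 𝕜 n) : tr (dev A) = 0 := by
  have hn' : (n : 𝕜) ≠ 0 := Nat.cast_ne_zero.2 hn
  simp only [tr, dev_apply, if_true, Finset.sum_sub_distrib, Finset.sum_const, Finset.card_univ,
    Fintype.card_fin, nsmul_eq_mul]
  rw [mul_div_cancel₀ _ hn', sub_self]

theorem sum_diag (a : Fin n × Fin n → 𝕜) :
    ∑ p, (if p.1 = p.2 then a p else 0) = ∑ i, a (i, i) := by
  simp [Fintype.sum_prod_type]

/-- The deviatoric part as a continuous linear map. -/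
noncomputable def devL (𝕜 : Type) [RCLike 𝕜] (n : ℕ) : Ten 𝕜 n →L[𝕜] Ten 𝕜 n :=
  LinearMap.toContinuousLinearMap
    { toFun := dev
      map_add' := fun A B => by
        ext p
        simp only [dev_apply, PiLp.add_apply, tr_add]
        split_ifs <;> ring
      map_smul' := fun a A => by
        ext p
        simp only [dev_apply, PiLp.smul_apply, tr_smul, RingHom.id_apply, smul_eq_mul]
        split_ifs <;> ring }

/-- `dev A - A` is a multiple of the identity and `dev B` is trace-free, so the two are orthogonal.
-/
theorem inner_dev_dev (hn : n ≠ 0) (A B : Ten 𝕜 n) :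
    inner 𝕜 (dev A) (dev B) = inner 𝕜 A (dev B) := by
  have h : inner 𝕜 (dev A - A) (dev B) = 0 := by
    have h1 : ∀ p : Fin n × Fin n, inner 𝕜 ((dev A - A) p) (dev B p) =
        if p.1 = p.2 then dev B p * conj (-(tr A / (n : 𝕜))) else 0 := by
      intro p
      rw [PiLp.sub_apply, dev_apply A]
      split_ifs <;> simp
    rw [PiLp.inner_apply, Finset.sum_congr rfl fun p _ => h1 p, sum_diag, ← Finset.sum_mul]
    exact mul_eq_zero_of_left (tr_dev hn B) _
  rw [inner_sub_left, sub_eq_zero] at h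
  exact h

theorem norm_dev_le (hn : n ≠ 0) (A : Ten 𝕜 n) : ‖dev A‖ ≤ ‖A‖ := by
  have h : ‖dev A‖ * ‖dev A‖ ≤ ‖A‖ * ‖dev A‖ := by
    rw [← inner_self_eq_norm_mul_norm (𝕜 := 𝕜), inner_dev_dev hn]
    exact re_inner_le_norm _ _
  rcases (norm_nonneg (dev A)).eq_or_lt with h0 | h0
  · rw [← h0]; exact norm_nonneg _
  · exact le_of_mul_le_mul_right h h0

theorem norm_dyad (s r : Vec 𝕜 n) : ‖dyad s r‖ = ‖s‖ * ‖r‖ := by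
  rw [EuclideanSpace.norm_eq, EuclideanSpace.norm_eq, EuclideanSpace.norm_eq,
    ← Real.sqrt_mul (by positivity), Finset.sum_mul_sum, Fintype.sum_prod_type]
  simp [dyad, mul_pow]

theorem continuous_dyad : Continuous fun p : Vec 𝕜 n × Vec 𝕜 n => dyad p.1 p.2 := by
  unfold dyad
  refine (PiLp.continuous_toLp 2 _).comp (continuous_pi fun p => ?_)
  have := RCLike.continuous_conj (K := 𝕜)
  fun_prop

theorem dyad_add (s s' r : Vec 𝕜 n) : dyad (s + s') r = dyad s r + dyad s' r := by
  ext p; simp [dyad, add_mul]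

theorem dyad_smul (a : 𝕜) (s r : Vec 𝕜 n) : dyad (a • s) r = a • dyad s r := by
  ext p; simp [dyad, mul_assoc]

/-! ### Test fields and the graph space of the divergence -/

/-- The tensor field whose `i`-th row is the gradient of `φ`. -/
noncomputable def gradRow (𝕜 : Type) [RCLike 𝕜] (φ : Pt n → ℝ) (i : Fin n) (x : Pt n) : Ten 𝕜 n :=
  WithLp.toLp 2 fun p => if p.1 = i then (pd φ p.2 x : 𝕜) else 0

/-- The vector field with `i`-th entry `φ`. -/
noncomputable def scalarEntry (𝕜 : Type) [RCLike 𝕜] (φ : Pt n → ℝ) (i : Fin n) (x : Pt n) :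
    Vec 𝕜 n :=
  EuclideanSpace.single i (φ x : 𝕜)

/-- The identity tensor. -/
noncomputable def idTen (𝕜 : Type) [RCLike 𝕜] (n : ℕ) : Ten 𝕜 n :=
  WithLp.toLp 2 fun p => if p.1 = p.2 then 1 else 0

theorem inner_idTen (A : Ten 𝕜 n) : inner 𝕜 (idTen 𝕜 n) A = tr A := by
  have h1 : ∀ p : Fin n × Fin n, inner 𝕜 (idTen 𝕜 n p) (A p) = if p.1 = p.2 then A p else 0 := by
    intro p
    simp only [idTen]
    split_ifs <;> simp
  rw [PiLp.inner_apply, Finset.sum_congr rfl fun p _ => h1 p, sum_diag]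
  rfl

theorem inner_gradRow (φ : Pt n → ℝ) (i : Fin n) (x : Pt n) (A : Ten 𝕜 n) :
    inner 𝕜 (gradRow 𝕜 φ i x) A = ∑ j, pd φ j x • A (i, j) := by
  have h1 : ∀ k j : Fin n, inner 𝕜 (gradRow 𝕜 φ i x (k, j)) (A (k, j)) =
      if k = i then pd φ j x • A (k, j) else 0 := by
    intro k j
    simp only [gradRow]
    split_ifs <;> simp [RCLike.real_smul_eq_coe_mul, mul_comm]
  rw [PiLp.inner_apply, Fintype.sum_prod_type]
  simp only [h1]
  rw [Finset.sum_comm]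
  simp

theorem inner_scalarEntry (φ : Pt n → ℝ) (i : Fin n) (x : Pt n) (v : Vec 𝕜 n) :
    inner 𝕜 (scalarEntry 𝕜 φ i x) v = φ x • v i := by
  simp [scalarEntry, EuclideanSpace.inner_single_left, RCLike.real_smul_eq_coe_mul]

variable {Ω : Set (Pt n)}

theorem memLp_gradRow {φ : Pt n → ℝ} (hφ : IsTest Ω φ) (i : Fin n) :
    MemLp (gradRow 𝕜 φ i) 2 (volume.restrict Ω) := by
  obtain ⟨h1, h2, -⟩ := hφ
  have hc : Continuous (fderiv ℝ φ) := h1.continuous_fderiv (by simp)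
  refine Continuous.memLp_of_hasCompactSupport ?_ ?_
  · unfold gradRow pd
    refine (PiLp.continuous_toLp 2 _).comp (continuous_pi fun p => ?_)
    split_ifs
    · exact RCLike.continuous_ofReal.comp (hc.clm_apply continuous_const)
    · exact continuous_const
  · refine (h2.fderiv ℝ).mono fun x hx => ?_
    contrapose! hx
    have hx' : fderiv ℝ φ x = 0 := by simpa using hx
    have : gradRow 𝕜 φ i x = 0 := by
      ext p; simp [gradRow, pd, hx']
    simp [this]

theorem memLp_scalarEntry {φ : Pt n → ℝ} (hφ : IsTest Ω φ) (i : Fin n) :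
    MemLp (scalarEntry 𝕜 φ i) 2 (volume.restrict Ω) := by
  obtain ⟨h1, h2, -⟩ := hφ
  refine Continuous.memLp_of_hasCompactSupport ?_ ?_
  · unfold scalarEntry
    have h3 : Continuous fun x => (φ x : 𝕜) := RCLike.continuous_ofReal.comp h1.continuous
    refine (PiLp.continuous_toLp 2 _).comp (continuous_pi fun k => ?_)
    by_cases hk : k = i
    · subst hk; simp only [Pi.single_eq_same]; exact h3
    · simp only [Pi.single_eq_of_ne hk]; exact continuous_const
  · refine h2.mono fun x hx => ?_
    contrapose! hx
    have hx' : φ x = 0 := by simpa using hx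
    simp [scalarEntry, hx']

theorem inner_toLp_left {E : Type*} [NormedAddCommGroup E] [InnerProductSpace 𝕜 E]
    {α : Type*} [MeasurableSpace α] {μ : Measure α} {F : α → E} (hF : MemLp F 2 μ) (g : Lp E 2 μ) :
    inner 𝕜 (hF.toLp F) g = ∫ x, inner 𝕜 (F x) (g x) ∂μ := by
  rw [L2.inner_def]
  refine integral_congr_ae ?_
  filter_upwards [hF.coeFn_toLp] with x hx
  rw [hx]

/-- Each weak divergence identity is orthogonality of (τ, g) to one fixed L² pair built from φ and
i; this is what makes the graph closed. -/
theorem hasWeakDiv_iff (τ : L2Ten 𝕜 Ω) (g : L2Vec 𝕜 Ω) :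
    HasWeakDiv Ω τ g ↔ ∀ (φ : Pt n → ℝ) (hφ : IsTest Ω φ) (i : Fin n),
      inner 𝕜 (WithLp.toLp 2 ((memLp_gradRow (𝕜 := 𝕜) hφ i).toLp,
        (memLp_scalarEntry (𝕜 := 𝕜) hφ i).toLp)) (WithLp.toLp 2 (τ, g)) = 0 := by
  refine forall_congr' fun φ => forall_congr' fun hφ => forall_congr' fun i => ?_
  rw [WithLp.prod_inner_apply]
  simp only [inner_toLp_left, inner_gradRow, inner_scalarEntry]
  rw [eq_neg_iff_add_eq_zero]

variable (𝕜 Ω) in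
/-- Fields whose orthogonal complement is the graph of the divergence on `H_0`. -/
def graphAnnihilator [IsFiniteMeasure (volume.restrict Ω)] :
    Set (WithLp 2 (L2Ten 𝕜 Ω × L2Vec 𝕜 Ω)) :=
  {z | ∃ (φ : Pt n → ℝ) (hφ : IsTest Ω φ) (i : Fin n),
    z = WithLp.toLp 2 ((memLp_gradRow (𝕜 := 𝕜) hφ i).toLp,
      (memLp_scalarEntry (𝕜 := 𝕜) hφ i).toLp)} ∪
  {WithLp.toLp 2 ((memLp_const (idTen 𝕜 n)).toLp, 0)}

variable (𝕜 Ω) in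
/-- The graph of the divergence on `H_0`, a closed subspace. -/
noncomputable def graphSpace [IsFiniteMeasure (volume.restrict Ω)] :
    Submodule 𝕜 (WithLp 2 (L2Ten 𝕜 Ω × L2Vec 𝕜 Ω)) :=
  (Submodule.span 𝕜 (graphAnnihilator 𝕜 Ω))ᗮ

/-- The test pairs encode the weak divergence and the pair (I, 0) encodes the vanishing mean trace;
I is square integrable because Ω has finite measure. -/
theorem mem_graphSpace_iff [IsFiniteMeasure (volume.restrict Ω)]
    (z : WithLp 2 (L2Ten 𝕜 Ω × L2Vec 𝕜 Ω)) :
    z ∈ graphSpace 𝕜 Ω ↔ HasWeakDiv Ω z.fst z.snd ∧ ∫ x in Ω, tr (z.fst x) = 0 := by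
  have h1 : z ∈ graphSpace 𝕜 Ω ↔ ∀ u ∈ graphAnnihilator 𝕜 Ω, inner 𝕜 u z = 0 := by
    rw [graphSpace, Submodule.mem_orthogonal]
    refine ⟨fun h u hu => h u (Submodule.subset_span hu), fun h u hu => ?_⟩
    induction hu using Submodule.span_induction with
    | mem u hu => exact h u hu
    | zero => exact inner_zero_left _
    | add a b _ _ ha hb => rw [inner_add_left, ha, hb, add_zero]
    | smul c a _ ha => rw [inner_smul_left, ha, mul_zero]
  have h2 : inner 𝕜 (WithLp.toLp 2 ((memLp_const (idTen 𝕜 n)).toLp, (0 : L2Vec 𝕜 Ω))) z =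
      ∫ x in Ω, tr (z.fst x) := by
    rw [WithLp.prod_inner_apply]
    simp only [inner_toLp_left, inner_idTen, inner_zero_left, add_zero]
    rfl
  rw [h1, hasWeakDiv_iff, ← h2]
  constructor
  · intro h
    exact ⟨fun φ hφ i => h _ (Or.inl ⟨φ, hφ, i, rfl⟩), h _ (Or.inr rfl)⟩
  · rintro ⟨ha, hb⟩ u (⟨φ, hφ, i, rfl⟩ | rfl)
    · exact ha φ hφ i
    · exact hb

/-! ### The operators of the problem -/

theorem norm_dyad_ae_le {β : Pt n → Vec 𝕜 n} (hβ : MemLp β ∞ (volume.restrict Ω)) (v : L2Vec 𝕜 Ω) :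
    ∀ᵐ x ∂(volume.restrict Ω),
      ‖dyad (v x) (β x)‖ ≤ (eLpNorm β ∞ (volume.restrict Ω)).toReal * ‖v x‖ := by
  have h := ae_le_eLpNormEssSup (f := β) (μ := volume.restrict Ω)
  filter_upwards [h] with x hx
  rw [norm_dyad, mul_comm]
  refine mul_le_mul_of_nonneg_right ?_ (norm_nonneg _)
  rw [← toReal_enorm, eLpNorm_exponent_top]
  exact ENNReal.toReal_mono (by simpa [eLpNorm_exponent_top] using hβ.2.ne) hx

theorem memLp_dyad {β : Pt n → Vec 𝕜 n} (hβ : MemLp β ∞ (volume.restrict Ω)) (v : L2Vec 𝕜 Ω) :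
    MemLp (fun x => dyad (v x) (β x)) 2 (volume.restrict Ω) :=
  (Lp.memLp v).of_le_mul
    (continuous_dyad.comp_aestronglyMeasurable ((Lp.aestronglyMeasurable v).prodMk hβ.1))
    (norm_dyad_ae_le hβ v)

theorem norm_toLp_dyad_le {β : Pt n → Vec 𝕜 n} (hβ : MemLp β ∞ (volume.restrict Ω))
    (v : L2Vec 𝕜 Ω) :
    ‖(memLp_dyad hβ v).toLp‖ ≤ (eLpNorm β ∞ (volume.restrict Ω)).toReal * ‖v‖ := by
  refine Lp.norm_le_mul_norm_of_ae_le_mul ?_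
  filter_upwards [norm_dyad_ae_le hβ v, (memLp_dyad hβ v).coeFn_toLp] with x h1 h2
  rwa [h2]

/-- The map `v ↦ v ⊗ β` on `L²`, for `β ∈ L^∞`. -/
noncomputable def dyadL {β : Pt n → Vec 𝕜 n} (hβ : MemLp β ∞ (volume.restrict Ω)) :
    L2Vec 𝕜 Ω →L[𝕜] L2Ten 𝕜 Ω :=
  LinearMap.mkContinuous
    { toFun := fun v => (memLp_dyad hβ v).toLp
      map_add' := fun v w => by
        refine Lp.ext ?_
        filter_upwards [(memLp_dyad hβ (v + w)).coeFn_toLp, (memLp_dyad hβ v).coeFn_toLp,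
          (memLp_dyad hβ w).coeFn_toLp, Lp.coeFn_add v w,
          Lp.coeFn_add (memLp_dyad hβ v).toLp (memLp_dyad hβ w).toLp] with x h1 h2 h3 h4 h5
        rw [h1, h5, Pi.add_apply, h2, h3, h4, Pi.add_apply, dyad_add]
      map_smul' := fun a v => by
        refine Lp.ext ?_
        filter_upwards [(memLp_dyad hβ (a • v)).coeFn_toLp, (memLp_dyad hβ v).coeFn_toLp,
          Lp.coeFn_smul a v, Lp.coeFn_smul a (memLp_dyad hβ v).toLp] with x h1 h2 h3 h4
        rw [h1, RingHom.id_apply, h4, Pi.smul_apply, h2, h3, Pi.smul_apply, dyad_smul] }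
    _ (norm_toLp_dyad_le hβ)

theorem coeFn_dyadL {β : Pt n → Vec 𝕜 n} (hβ : MemLp β ∞ (volume.restrict Ω)) (v : L2Vec 𝕜 Ω) :
    dyadL hβ v =ᵐ[volume.restrict Ω] fun x => dyad (v x) (β x) :=
  (memLp_dyad hβ v).coeFn_toLp

variable (𝕜 Ω) in
/-- The deviatoric part on `L²`. -/
noncomputable def devLp : L2Ten 𝕜 Ω →L[𝕜] L2Ten 𝕜 Ω :=
  (devL 𝕜 n).compLpL 2 (volume.restrict Ω)

theorem coeFn_devLp (τ : L2Ten 𝕜 Ω) :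
    devLp 𝕜 Ω τ =ᵐ[volume.restrict Ω] fun x => dev (τ x) :=
  (devL 𝕜 n).coeFn_compLpL τ

theorem norm_devLp_le (hn : n ≠ 0) (τ : L2Ten 𝕜 Ω) : ‖devLp 𝕜 Ω τ‖ ≤ ‖τ‖ := by
  refine Lp.norm_le_norm_of_ae_le ?_
  filter_upwards [coeFn_devLp τ] with x hx
  rw [hx]
  exact norm_dev_le hn _

theorem norm_devLp_sq (τ : L2Ten 𝕜 Ω) : ‖devLp 𝕜 Ω τ‖ ^ 2 = ∫ x in Ω, ‖dev (τ x)‖ ^ 2 := by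
  have h : ((‖devLp 𝕜 Ω τ‖ ^ 2 : ℝ) : 𝕜) = ((∫ x in Ω, ‖dev (τ x)‖ ^ 2 : ℝ) : 𝕜) := by
    rw [RCLike.ofReal_pow, ← inner_self_eq_norm_sq_to_K, L2.inner_def, ← integral_ofReal]
    refine integral_congr_ae ?_
    filter_upwards [coeFn_devLp τ] with x hx
    rw [hx, inner_self_eq_norm_sq_to_K, RCLike.ofReal_pow]
  exact RCLike.ofReal_injective h

theorem formA_eq (ν : ℝ) (ρ τ : L2Ten 𝕜 Ω) :
    formA ν ρ τ = ((1 / ν : ℝ) : 𝕜) * inner 𝕜 (devLp 𝕜 Ω τ) (devLp 𝕜 Ω ρ) := by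
  rw [formA, L2.inner_def]
  congr 1
  refine integral_congr_ae ?_
  filter_upwards [coeFn_devLp τ, coeFn_devLp ρ] with x h1 h2
  rw [h1, h2, ddot_eq_inner]

theorem formB_eq (τ : L2Ten 𝕜 Ω) (v : L2Vec 𝕜 Ω) : formB τ v = inner 𝕜 v (divg τ) := by
  simp only [formB, L2.inner_def, dot_eq_inner]

/-- The deviator may be put on τ as well, so a and c combine into a single inner product with the
deviator of τ. -/
theorem formC_eq (hn : n ≠ 0) (ν : ℝ) {β : Pt n → Vec 𝕜 n}
    (hβ : MemLp β ∞ (volume.restrict Ω)) (v : L2Vec 𝕜 Ω) (τ : L2Ten 𝕜 Ω) :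
    formC ν β v τ =
      ((1 / ν : ℝ) : 𝕜) * inner 𝕜 (devLp 𝕜 Ω τ) (devLp 𝕜 Ω (dyadL hβ v)) := by
  rw [formC, L2.inner_def]
  congr 1
  refine integral_congr_ae ?_
  filter_upwards [coeFn_devLp τ, coeFn_devLp (dyadL hβ v), coeFn_dyadL hβ v] with x h1 h2 h3
  rw [h1, h2, h3, ddot_eq_inner, inner_dev_dev hn]

theorem integral_dot_eq (f v : L2Vec 𝕜 Ω) : ∫ x in Ω, dot (f x) (v x) = inner 𝕜 v f := by
  simp only [L2.inner_def, dot_eq_inner]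

/-- Small data forces the coercivity constant to be positive. -/
theorem c1_pos_of_smallData (hgam : gam 𝕜 Ω ≠ ⊤) {ν : ℝ} (hν : 0 < ν) {β : Pt n → Vec 𝕜 n}
    {f : L2Vec 𝕜 Ω} (h : SmallData ν β f) : 0 < c1 𝕜 Ω := by
  obtain ⟨R, hR, h⟩ := h
  by_contra hc
  have hc0 : c1 𝕜 Ω = 0 := nonpos_iff_eq_zero.1 (not_lt.1 hc)
  have hν0 : ENNReal.ofReal ν ≠ 0 := (ENNReal.ofReal_pos.2 hν).ne'
  have hA : normA ν ≠ 0 := by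
    rw [normA, ne_eq, ← nonpos_iff_eq_zero, not_le, lt_min_iff]
    exact ⟨one_pos, ENNReal.div_pos one_ne_zero ENNReal.ofReal_ne_top⟩
  -- With c₁ = 0 the quotient ν / c₁ is infinite. As γ is finite, C₁ ≠ 0, so the R₀² term is
  -- infinite and cannot be at most R₀.
  have hH : constH 𝕜 Ω ν = ⊤ := by
    rw [constH, hc0, ENNReal.div_zero hν0, ENNReal.top_mul hA, add_top]
  have hC : constC1 𝕜 Ω ν ≠ 0 := by
    refine (ENNReal.div_pos one_ne_zero ?_).ne'
    exact ENNReal.mul_ne_top (ENNReal.mul_ne_top (by simp) ENNReal.ofReal_ne_top) hgam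
  have hR0 : ENNReal.ofReal R ^ 2 ≠ 0 := pow_ne_zero _ (ENNReal.ofReal_pos.2 hR).ne'
  rw [hH, ENNReal.top_mul hC, ENNReal.top_div_of_ne_top (by simp), ENNReal.top_mul hR0,
    top_add] at h
  exact absurd h (by simp)

/-! ### The source problem on the graph space -/

variable [IsFiniteMeasure (volume.restrict Ω)]

theorem fst_mem_H0 {z : WithLp 2 (L2Ten 𝕜 Ω × L2Vec 𝕜 Ω)} (hz : z ∈ graphSpace 𝕜 Ω) :
    z.fst ∈ H0 𝕜 Ω :=
  ⟨⟨z.snd, ((mem_graphSpace_iff z).1 hz).1⟩, ((mem_graphSpace_iff z).1 hz).2⟩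

theorem divg_fst (hΩ : IsOpen Ω) {z : WithLp 2 (L2Ten 𝕜 Ω × L2Vec 𝕜 Ω)}
    (hz : z ∈ graphSpace 𝕜 Ω) : divg z.fst = z.snd :=
  divg_eq hΩ ((mem_graphSpace_iff z).1 hz).1

theorem divNorm_fst (hΩ : IsOpen Ω) {z : WithLp 2 (L2Ten 𝕜 Ω × L2Vec 𝕜 Ω)}
    (hz : z ∈ graphSpace 𝕜 Ω) : divNorm z.fst = ‖z‖ := by
  rw [divNorm, divg_fst hΩ hz, WithLp.prod_norm_eq_of_L2]

theorem mem_graphSpace_of_mem_H0 (hΩ : IsOpen Ω) {τ : L2Ten 𝕜 Ω} (hτ : τ ∈ H0 𝕜 Ω) :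
    WithLp.toLp 2 (τ, divg τ) ∈ graphSpace 𝕜 Ω := by
  obtain ⟨⟨g, hg⟩, h⟩ := hτ
  refine (mem_graphSpace_iff _).2 ⟨?_, h⟩
  rw [divg_eq hΩ hg]
  exact hg

variable (𝕜 Ω) in
/-- The divergence on the graph space. -/
noncomputable def graphDiv : graphSpace 𝕜 Ω →L[𝕜] L2Vec 𝕜 Ω :=
  WithLp.sndL 2 𝕜 _ _ ∘L (graphSpace 𝕜 Ω).subtypeL

variable (𝕜 Ω) in
/-- The deviatoric part on the graph space. -/
noncomputable def graphDev : graphSpace 𝕜 Ω →L[𝕜] L2Ten 𝕜 Ω :=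
  devLp 𝕜 Ω ∘L WithLp.fstL 2 𝕜 _ _ ∘L (graphSpace 𝕜 Ω).subtypeL

@[simp] theorem graphDiv_apply (z : graphSpace 𝕜 Ω) : graphDiv 𝕜 Ω z = z.1.snd := rfl

@[simp] theorem graphDev_apply (z : graphSpace 𝕜 Ω) :
    graphDev 𝕜 Ω z = devLp 𝕜 Ω z.1.fst := rfl

instance : CompleteSpace (graphSpace 𝕜 Ω) :=
  (Submodule.isClosed_orthogonal _).completeSpace_coe

/-- The source problem as an operator equation on the graph space. -/
theorem isSourceSolution_iff (hn : n ≠ 0) (hΩ : IsOpen Ω) {ν : ℝ} (hν : 0 < ν)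
    {β : Pt n → Vec 𝕜 n} (hβ : MemLp β ∞ (volume.restrict Ω)) (f : L2Vec 𝕜 Ω)
    (z : graphSpace 𝕜 Ω) (u : L2Vec 𝕜 Ω) :
    IsSourceSolution ν β f z.1.fst u ↔
      (∀ τ, inner 𝕜 (graphDev 𝕜 Ω τ) (graphDev 𝕜 Ω z + (devLp 𝕜 Ω ∘L dyadL hβ) u) +
        (ν : 𝕜) * inner 𝕜 (graphDiv 𝕜 Ω τ) u = 0) ∧ graphDiv 𝕜 Ω z = -f := by
  have hνK : (ν : 𝕜) ≠ 0 := RCLike.ofReal_ne_zero.2 hν.ne'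
  -- Multiplying by ν clears the factor 1/ν from a and c and moves ν onto the divergence term.
  have key : ∀ τ : graphSpace 𝕜 Ω,
      formA ν z.1.fst τ.1.fst + conj (formB τ.1.fst u) + formC ν β u τ.1.fst = 0 ↔
      inner 𝕜 (graphDev 𝕜 Ω τ) (graphDev 𝕜 Ω z + (devLp 𝕜 Ω ∘L dyadL hβ) u) +
        (ν : 𝕜) * inner 𝕜 (graphDiv 𝕜 Ω τ) u = 0 := by
    intro τ
    rw [formA_eq, formB_eq, formC_eq hn ν hβ, inner_conj_symm, divg_fst hΩ τ.2, inner_add_right,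
      graphDev_apply, graphDev_apply, graphDiv_apply, ContinuousLinearMap.comp_apply,
      ← mul_right_inj' hνK, mul_zero]
    rw [RCLike.ofReal_div, RCLike.ofReal_one, mul_add, mul_add, ← mul_assoc, ← mul_assoc (ν : 𝕜),
      mul_one_div_cancel hνK, one_mul, one_mul, add_right_comm]
  refine ⟨fun ⟨_, h1, h2⟩ => ⟨fun τ => (key τ).1 (h1 _ (fst_mem_H0 τ.2)), ?_⟩,
    fun ⟨h1, h2⟩ => ⟨fst_mem_H0 z.2, fun τ hτ => ?_, fun v => ?_⟩⟩
  · refine ext_inner_left 𝕜 fun v => ?_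
    rw [graphDiv_apply, ← divg_fst hΩ z.2, ← formB_eq, h2, integral_dot_eq, inner_neg_right]
  · exact (key ⟨_, mem_graphSpace_of_mem_H0 hΩ hτ⟩).2 (h1 _)
  · rw [formB_eq, divg_fst hΩ z.2, ← graphDiv_apply, h2, integral_dot_eq, inner_neg_right]

/-! ### The constants -/

theorem enorm_inner_le {E : Type*} [NormedAddCommGroup E] [InnerProductSpace 𝕜 E] (x y : E) :
    ‖inner 𝕜 x y‖ₑ ≤ ‖x‖ₑ * ENNReal.ofReal ‖y‖ := by
  rw [← ofReal_norm, ← ofReal_norm, ← ENNReal.ofReal_mul (norm_nonneg _)]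
  exact ENNReal.ofReal_le_ofReal (norm_inner_le_norm _ _)

/-- Here b(τ, q) = ⟨D* q, τ⟩, so Cauchy–Schwarz bounds every quotient by ‖D* q‖. For g = ∞ the real
value is 0 and the bound is trivial. -/
theorem le_norm_adjoint_graphDiv (hΩ : IsOpen Ω) {g : ℝ≥0∞}
    (h : ∀ q : L2Vec 𝕜 Ω, g * ‖q‖ₑ ≤
      ⨆ τ ∈ H0 𝕜 Ω, ‖formB τ q‖ₑ / ENNReal.ofReal (divNorm τ)) (q : L2Vec 𝕜 Ω) :
    g.toReal * ‖q‖ ≤ ‖ContinuousLinearMap.adjoint (graphDiv 𝕜 Ω) q‖ := by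
  have hz : ∀ z : graphSpace 𝕜 Ω, ‖formB z.1.fst q‖ₑ / ENNReal.ofReal (divNorm z.1.fst) ≤
      ‖ContinuousLinearMap.adjoint (graphDiv 𝕜 Ω) q‖ₑ := by
    intro z
    refine ENNReal.div_le_of_le_mul ?_
    have e : formB z.1.fst q =
        inner 𝕜 (ContinuousLinearMap.adjoint (graphDiv 𝕜 Ω) q) z := by
      rw [ContinuousLinearMap.adjoint_inner_left, formB_eq, divg_fst hΩ z.2, graphDiv_apply]
    rw [e, divNorm_fst hΩ z.2]
    exact enorm_inner_le _ _
  have h1 : g * ‖q‖ₑ ≤ ‖ContinuousLinearMap.adjoint (graphDiv 𝕜 Ω) q‖ₑ :=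
    (h q).trans (iSup₂_le fun τ hτ => hz ⟨_, mem_graphSpace_of_mem_H0 hΩ hτ⟩)
  have h2 := ENNReal.toReal_mono (by simp) h1
  rwa [ENNReal.toReal_mul, toReal_enorm, toReal_enorm] at h2

/-- Cauchy–Schwarz and ‖div τ‖ ≤ ‖τ‖_div bound every quotient by ‖q‖. A nonzero constant field q,
available since Ω has positive finite measure, then rules out g > 1, so γ is finite. -/
theorem gam_le_one (hn : n ≠ 0) (hΩ : IsOpen Ω) (hne : Ω.Nonempty) : gam 𝕜 Ω ≤ 1 := by
  refine sSup_le fun g hg => ?_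
  have : Nonempty (Fin n) := ⟨⟨0, Nat.pos_of_ne_zero hn⟩⟩
  obtain ⟨w, hw⟩ := exists_ne (0 : Vec 𝕜 n)
  have hμ : (volume.restrict Ω) univ ≠ 0 := by
    rw [Measure.restrict_apply_univ]
    exact (hΩ.measure_pos _ hne).ne'
  set q : L2Vec 𝕜 Ω := indicatorConstLp 2 MeasurableSet.univ (measure_ne_top _ _) w
  have hq : ‖q‖ₑ ≠ 0 := by
    rw [enorm_ne_zero, ← norm_ne_zero_iff, norm_indicatorConstLp (by simp) (by simp)]
    refine mul_ne_zero (norm_ne_zero_iff.2 hw) ?_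
    refine (Real.rpow_pos_of_pos ?_ _).ne'
    exact ENNReal.toReal_pos hμ (measure_ne_top _ _)
  have h1 : g * ‖q‖ₑ ≤ 1 * ‖q‖ₑ := by
    refine (hg q).trans (iSup₂_le fun τ hτ => ENNReal.div_le_of_le_mul ?_)
    rw [formB_eq, one_mul]
    refine (enorm_inner_le _ _).trans ?_
    gcongr
    rw [divNorm]
    exact Real.le_sqrt_of_sq_le (le_add_of_nonneg_left (sq_nonneg _))
  exact (ENNReal.mul_le_mul_iff_left hq (by simp)).1 h1

theorem exists_coercive_of_c1_pos (hΩ : IsOpen Ω) (h : 0 < c1 𝕜 Ω) :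
    ∃ c : ℝ, 0 < c ∧ ∀ z : graphSpace 𝕜 Ω,
      c * ‖z‖ ^ 2 ≤ ‖graphDev 𝕜 Ω z‖ ^ 2 + ‖graphDiv 𝕜 Ω z‖ ^ 2 := by
  obtain ⟨c, hc, hc0⟩ := lt_sSup_iff.1 h
  -- The admissible c may be ∞, whose real value is 0; capping at 1 keeps the constant positive and
  -- finite.
  have hmin : min c 1 ≠ ⊤ := ((min_le_right _ _).trans_lt ENNReal.one_lt_top).ne
  refine ⟨(min c 1).toReal, ENNReal.toReal_pos (lt_min hc0 one_pos).ne' hmin, fun z => ?_⟩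
  have h1 := (mul_le_mul_left (min_le_left c 1) _).trans (hc _ (fst_mem_H0 z.2))
  rw [divNorm_fst hΩ z.2, divg_fst hΩ z.2, ← norm_devLp_sq] at h1
  have h2 := ENNReal.toReal_mono ENNReal.ofReal_ne_top h1
  rwa [ENNReal.toReal_mul, ENNReal.toReal_ofReal (by positivity),
    ENNReal.toReal_ofReal (by positivity)] at h2

end Oseen

/-! ### The main theorem -/

theorem mainTheorem1 {𝕜 : Type} [RCLike 𝕜] (n : ℕ) (hn : n = 2 ∨ n = 3)
    (Ω : Set (Oseen.Pt n)) (hΩ_open : IsOpen Ω) (hΩ_conn : IsConnected Ω)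
    (hΩ_bdd : Bornology.IsBounded Ω)
    (ν : ℝ) (hν : 0 < ν)
    (β : Oseen.Pt n → Oseen.Vec 𝕜 n) (hβ : Oseen.MemW1Inf Ω β) (hβ_div : Oseen.IsDivFree Ω β)
    (f : Oseen.L2Vec 𝕜 Ω)
    (hsmall : Oseen.SmallData ν β f)
    (hcontr : Oseen.w1InfNorm Ω β * max (1 / ENNReal.ofReal ν) (1 / Oseen.c1 𝕜 Ω)
      < Oseen.gam 𝕜 Ω) :
    ∃! p : Oseen.L2Ten 𝕜 Ω × Oseen.L2Vec 𝕜 Ω, Oseen.IsSourceSolution ν β f p.1 p.2 := by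
  open Oseen in
  have hn0 : n ≠ 0 := by omega
  have : IsFiniteMeasure (volume.restrict Ω) :=
    ⟨by rw [Measure.restrict_apply_univ]; exact hΩ_bdd.measure_lt_top⟩
  have hgam : gam 𝕜 Ω ≤ 1 := gam_le_one hn0 hΩ_open hΩ_conn.nonempty
  have hgam' : gam 𝕜 Ω ≠ ⊤ := (hgam.trans_lt ENNReal.one_lt_top).ne
  obtain ⟨c, hc, hcoer⟩ := exists_coercive_of_c1_pos hΩ_open (c1_pos_of_smallData hgam' hν hsmall)
  have hlt : eLpNorm β ∞ (volume.restrict Ω) * (1 / ENNReal.ofReal ν) < gam 𝕜 Ω :=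
    (mul_le_mul' (le_max_left _ _) (le_max_left _ _)).trans_lt hcontr
  -- An admissible g strictly above ‖β‖/ν suffices, so attainment of the supremum γ need not be
  -- shown.
  obtain ⟨g, hg, hlt⟩ := lt_sSup_iff.1 hlt
  have hg1 : g ≠ ⊤ := ((le_sSup hg).trans_lt hgam'.lt_top).ne
  have hg0 : 0 < g.toReal := ENNReal.toReal_pos (pos_of_gt hlt).ne' hg1
  have hMg : (eLpNorm β ∞ (volume.restrict Ω)).toReal < ν * g.toReal := by
    have h1 := (ENNReal.toReal_lt_toReal hlt.ne_top hg1).2 hlt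
    rw [ENNReal.toReal_mul, ENNReal.toReal_div, ENNReal.toReal_one, ENNReal.toReal_ofReal hν.le,
      mul_one_div, div_lt_iff₀ hν] at h1
    linarith
  obtain ⟨⟨z, u⟩, hzu, huniq⟩ := existsUnique_perturbed_saddle (graphDev 𝕜 Ω) (graphDiv 𝕜 Ω)
    (devLp 𝕜 Ω ∘L dyadL hβ.1) hc hg0 hν ENNReal.toReal_nonneg hMg
    (fun z => (norm_devLp_le hn0 _).trans (WithLp.norm_fst_le _ z.1)) hcoer
    (le_norm_adjoint_graphDiv hΩ_open hg)
    (fun q => (norm_devLp_le hn0 _).trans (norm_toLp_dyad_le hβ.1 q)) (-f)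
  refine ⟨(z.1.fst, u), (isSourceSolution_iff hn0 hΩ_open hν hβ.1 f z u).2 hzu, ?_⟩
  rintro ⟨σ, w⟩ hσ
  -- Any solution has σ in `H0`, so it lifts to the graph space, where uniqueness applies.
  have h1 := huniq (⟨_, mem_graphSpace_of_mem_H0 hΩ_open hσ.1⟩, w)
    ((isSourceSolution_iff hn0 hΩ_open hν hβ.1 f ⟨_, mem_graphSpace_of_mem_H0 hΩ_open hσ.1⟩ w).1 hσ)
  obtain ⟨hz, hw⟩ := Prod.ext_iff.1 h1
  exact Prod.ext (congrArg (fun y : graphSpace 𝕜 Ω => y.1.fst) hz) hw
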